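/- Let $\mathcal H$ be a separable complex Hilbert space (inner product linear in the second argument) and let $H_0\ge 0$ be a self-adjoint operator in $\mathcal H$ with spectral family $E(\cdot)$; write $\rho(\cdot)$ for resolvent sets and $R_0(z)=(H_0-z)^{-1}$. Use the branch $z^{1/2}=|z|^{1/2}e^{i\arg(z)/2}$, $\arg(z)\in[0,2\pi)$, $0^{1/2}=0$, and set $$(H_0-z)^{1/2}=\int_{\sigma(H_0)}(\lambda-z)^{1/2}\,dE(\lambda)\quad(z\in\mathbb C),\qquad R_0(z)^{1/2}=(H_0-z)^{-1/2}=\int_{\sigma(H_0)}\frac{1}{(\lambda-z)^{1/2}}\,dE(\lambda)\quad(z\in\rho(H_0)).$$ Let $\mathcal H_{+1}=\operatorname{dom}(H_0^{1/2})$ with inner product $(f,g)_{+1}=(H_0^{1/2}f,H_0^{1/2}g)_{\mathcal H}+(f,g)_{\mathcal H}$, and let $\mathcal H_{-1}$ be the space of bounded conjugate-linear functionals on $\mathcal H_{+1}$, with $\mathcal H\subset\mathcal H_{-1}$ via $f\mapsto(\,\cdot\,,f)_{\mathcal H}$. For $z\in\rho(H_0)$ the operator $(H_0-z)^{-1/2}$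 is bounded from $\mathcal H$ to $\mathcal H_{+1}$, and it extends to a bounded operator $\mathcal H_{-1}\to\mathcal H$, denoted by the same symbol, which sends $\Psi$ to the vector $f_\Psi$ with $(g,f_\Psi)_{\mathcal H}=\Psi\big(((H_0-z)^{-1/2})^*g\big)$ for all $g\in\mathcal H$. Let $V:\mathcal H_{+1}\to\mathcal H_{-1}$ be a bounded linear operator and put $$A_V(z)=-(H_0-z)^{-1/2}\,V\,(H_0-z)^{-1/2}\in\mathcal B(\mathcal H),\qquad z\in\rho(H_0).$$ Assume that $A_V(z)$ is compact for some $z\in\rho(H_0)$ and that $\|A_V(E_0)\|_{\mathcal B(\mathcal H)}<1$ for some $E_0\in(-\infty,0)$. For $z$ in the (nonempty) set $\Omega=\{z\in\rho(H_0)\mid 1\in\rho(A_V(z))\}$ put $$R(z)=(H_0-z)^{-1/2}\,[I-A_V(z)]^{-1}\,(H_0-z)^{-1/2}.$$ Fix $z_0\in\Omega$ and let $H$ be the operator in $\mathcal H$ with $R(z_0)=(H-z_0)^{-1}$, that is, $H=z_0+R(z_0)^{-1}$ on $\operatorname{dom}(H)=\operatorname{ran}(R(z_0))$. Then $H$ is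 well defined, densely defined and closed, and $R(z)=(H-z)^{-1}$ for every $z\in\Omega$ (so $H$ does not depend on $z_0$). Moreover, for every $\lambda_0\in\rho(H_0)$: 1. If $Hf=\lambda_0f$ with $0\ne f\in\operatorname{dom}(H)$, then $f\in\operatorname{dom}((H_0-\lambda_0)^{1/2})$, and $g=(H_0-\lambda_0)^{1/2}f$ satisfies $g\neq0$ and $A_V(\lambda_0)g=g$. 2. Conversely, if $A_V(\lambda_0)g=g$ with $0\ne g\in\mathcal H$, then $f=R_0(\lambda_0)^{1/2}g$ satisfies $0\ne f\in\operatorname{dom}(H)$ and $Hf=\lambda_0f$. 3. $\dim\ker(H-\lambda_0)=\dim\ker(I-A_V(\lambda_0))<\infty$. Finally, for every $z\in\rho(H_0)$ one has $z\in\rho(H)$ if and only if $1\in\rho(A_V(z))$. -/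

import Mathlib

open scoped InnerProductSpace

namespace BirmanSchwinger

noncomputable section

variable {𝓗 : Type*} [NormedAddCommGroup 𝓗] [InnerProductSpace ℂ 𝓗]

/-! ### Unbounded operators and their resolvents -/

/-- `R` is the bounded, everywhere defined, two-sided inverse of `T - z`, that is
`R = (T - z)⁻¹`. -/
def IsResolventAt (T : 𝓗 →ₗ.[ℂ] 𝓗) (z : ℂ) (R : 𝓗 →L[ℂ] 𝓗) : Prop :=
  (∀ y : 𝓗, ∃ h : R y ∈ T.domain, T ⟨R y, h⟩ - z • R y = y) ∧
    ∀ x : T.domain, R (T x - z • (x : 𝓗)) = x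

/-- The resolvent set `ρ(T)` of an operator `T` in `𝓗`. -/
def rho (T : 𝓗 →ₗ.[ℂ] 𝓗) : Set ℂ :=
  {z | ∃ R : 𝓗 →L[ℂ] 𝓗, IsResolventAt T z R}

open Classical in
/-- The resolvent `(T - z)⁻¹` for `z ∈ ρ(T)` (and the value `0` for other `z`). -/
def resolventOp (T : 𝓗 →ₗ.[ℂ] 𝓗) (z : ℂ) : 𝓗 →L[ℂ] 𝓗 :=
  if h : ∃ R : 𝓗 →L[ℂ] 𝓗, IsResolventAt T z R then h.choose else 0

/-- The kernel of `T - z`, as a subspace of `𝓗`: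
the vectors `f ∈ dom(T)` with `T f = z f`. -/
def eigenspace (T : 𝓗 →ₗ.[ℂ] 𝓗) (z : ℂ) : Submodule ℂ 𝓗 :=
  T.graph.comap (LinearMap.id.prod (z • LinearMap.id))

theorem mem_eigenspace_iff (T : 𝓗 →ₗ.[ℂ] 𝓗) (z : ℂ) (f : 𝓗) :
    f ∈ eigenspace T z ↔ ∃ h : f ∈ T.domain, T ⟨f, h⟩ = z • f := by
  simp only [eigenspace, Submodule.mem_comap, LinearMap.prod_apply, LinearPMap.mem_graph_iff]
  constructor
  · rintro ⟨y, hy, hTy⟩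
    obtain rfl : (y : 𝓗) = f := hy
    exact ⟨y.2, hTy⟩
  · rintro ⟨h, hT⟩
    exact ⟨⟨f, h⟩, rfl, hT⟩

/-! ### The branch of the square root -/

/-- The square root on `ℂ` with branch `z^{1/2} = |z|^{1/2} e^{i arg(z)/2}`, `arg(z) ∈ [0, 2π)`,
and `0^{1/2} = 0`. (`Complex.arg` takes its values in `(-π, π]`.) -/
def csqrt (z : ℂ) : ℂ :=
  (Real.sqrt ‖z‖ : ℂ) *
    Complex.exp (Complex.I * ((if 0 ≤ z.arg then z.arg else z.arg + 2 * Real.pi : ℝ) : ℂ) / 2)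

/-! ### Functions of a nonnegative self-adjoint operator -/

section Calculus

variable [CompleteSpace 𝓗]

/-- The bounded operator `φ(H₀)`, for a self-adjoint `H₀ ≥ 0` and a function `φ` that is continuous
on `σ(H₀) ⊆ [0, ∞)` and tends to `0` at infinity (if `σ(H₀)` is unbounded).
It is obtained from the continuous functional calculus of the bounded self-adjoint operator
`(H₀ + 1)⁻¹` by the change of variable `b = (λ + 1)⁻¹`, `λ = b⁻¹ - 1`;
the point `b = 0` corresponds to `λ = ∞`, where `φ` vanishes. -/
def boundedFun (H₀ : 𝓗 →ₗ.[ℂ] 𝓗) (φ : ℝ → ℂ) : 𝓗 →L[ℂ] 𝓗 :=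
  cfc (fun b : ℂ => if b = 0 then 0 else φ ((b⁻¹).re - 1)) (resolventOp H₀ (-1))

/-- The closed operator `ψ(H₀)`, for a self-adjoint `H₀ ≥ 0` and a function `ψ` that is continuous
on `[0, ∞)` with `ψ(λ)/(1 + λ) → 0` at infinity:
`ψ(H₀) = (H₀ + 1) C` with the bounded operator `C = (ψ/(1 + λ))(H₀)`, on the maximal domain
`{f | C f ∈ dom(H₀)}`. In terms of the spectral family of `H₀` this is the set of the `f` with
`∫ |ψ(λ)|² d‖E(λ)f‖² < ∞`, so the operator is `∫ ψ(λ) dE(λ)`. -/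
def unboundedFun (H₀ : 𝓗 →ₗ.[ℂ] 𝓗) (ψ : ℝ → ℂ) : 𝓗 →ₗ.[ℂ] 𝓗 where
  domain := H₀.domain.comap
    (boundedFun H₀ (fun t => ψ t / (1 + t)) : 𝓗 →ₗ[ℂ] 𝓗)
  toFun :=
    { toFun := fun f => H₀ ⟨boundedFun H₀ (fun t => ψ t / (1 + t)) f, f.2⟩
        + boundedFun H₀ (fun t => ψ t / (1 + t)) f
      map_add' := by
        intro f g
        have h := H₀.map_add ⟨boundedFun H₀ (fun t => ψ t / (1 + t)) f, f.2⟩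
          ⟨boundedFun H₀ (fun t => ψ t / (1 + t)) g, g.2⟩
        simp only [Submodule.coe_add, map_add]
        rw [add_add_add_comm, ← h]
        rfl
      map_smul' := by
        intro c f
        have h := H₀.map_smul c ⟨boundedFun H₀ (fun t => ψ t / (1 + t)) f, f.2⟩
        simp only [Submodule.coe_smul, map_smul, RingHom.id_apply, smul_add]
        rw [← h]
        rfl }

/-- The operator `(H₀ - z)^{1/2}`, `z ∈ ℂ`. -/
def sqrtOp (H₀ : 𝓗 →ₗ.[ℂ] 𝓗) (z : ℂ) : 𝓗 →ₗ.[ℂ] 𝓗 :=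
  unboundedFun H₀ (fun t => csqrt (t - z))

/-- The bounded operator `(H₀ - z)^{-1/2} = R₀(z)^{1/2}`, `z ∈ ρ(H₀)`. -/
def invSqrt (H₀ : 𝓗 →ₗ.[ℂ] 𝓗) (z : ℂ) : 𝓗 →L[ℂ] 𝓗 :=
  boundedFun H₀ (fun t => 1 / csqrt (t - z))

/-! ### The scale of spaces -/

/-- The Hilbert space `𝓗₊₁(H₀)`: the set `dom(H₀^{1/2})` with the inner product
`(H₀^{1/2} f, H₀^{1/2} g) + (f, g)`. -/
def HPlus (H₀ : 𝓗 →ₗ.[ℂ] 𝓗) : Type _ := (sqrtOp H₀ 0).domain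

namespace HPlus

variable (H₀ : 𝓗 →ₗ.[ℂ] 𝓗)

instance : AddCommGroup (HPlus H₀) := inferInstanceAs (AddCommGroup (sqrtOp H₀ 0).domain)

instance : Module ℂ (HPlus H₀) := inferInstanceAs (Module ℂ (sqrtOp H₀ 0).domain)

/-- The inclusion `𝓗₊₁(H₀) ⊆ 𝓗`. -/
def incl : HPlus H₀ →ₗ[ℂ] 𝓗 := (sqrtOp H₀ 0).domain.subtype

/-- `H₀^{1/2}` as a linear map on its domain. -/
def sqrtMap : HPlus H₀ →ₗ[ℂ] 𝓗 := (sqrtOp H₀ 0).toFun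

theorem incl_injective : Function.Injective (incl H₀) := Subtype.val_injective

/-- The inner product of `𝓗₊₁(H₀)`, linear in the second argument. -/
abbrev innerCore : InnerProductSpace.Core ℂ (HPlus H₀) where
  inner f g := ⟪sqrtMap H₀ f, sqrtMap H₀ g⟫_ℂ + ⟪incl H₀ f, incl H₀ g⟫_ℂ
  conj_inner_symm f g := by simp [inner_conj_symm]
  re_inner_nonneg f := by
    simp only [map_add]
    exact add_nonneg inner_self_nonneg inner_self_nonneg
  add_left f g h := by
    simp only [map_add, inner_add_left]
    ring
  smul_left f g r := by
    simp only [map_smul, inner_smul_left]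
    ring
  definite f hf := by
    have h1 : (RCLike.re ⟪sqrtMap H₀ f, sqrtMap H₀ f⟫_ℂ : ℝ)
        + RCLike.re ⟪incl H₀ f, incl H₀ f⟫_ℂ = 0 := by
      have := congrArg (RCLike.re : ℂ → ℝ) hf
      simpa only [map_add, map_zero] using this
    have h2 : (0 : ℝ) ≤ RCLike.re ⟪sqrtMap H₀ f, sqrtMap H₀ f⟫_ℂ := inner_self_nonneg
    have h3 : (0 : ℝ) ≤ RCLike.re ⟪incl H₀ f, incl H₀ f⟫_ℂ := inner_self_nonneg
    have h4 : RCLike.re ⟪incl H₀ f, incl H₀ f⟫_ℂ = (0 : ℝ) := by linarith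
    have h5 : incl H₀ f = 0 := by
      rw [inner_self_eq_norm_sq] at h4
      simpa using h4
    exact incl_injective H₀ (by rw [h5, map_zero])

instance : NormedAddCommGroup (HPlus H₀) :=
  @InnerProductSpace.Core.toNormedAddCommGroup ℂ (HPlus H₀) _ _ _ (innerCore H₀)

instance : InnerProductSpace ℂ (HPlus H₀) := InnerProductSpace.ofCore (innerCore H₀).toCore

end HPlus

/-- The space `𝓗₋₁(H₀)` of bounded conjugate-linear functionals on `𝓗₊₁(H₀)`. -/
abbrev HMinus (H₀ : 𝓗 →ₗ.[ℂ] 𝓗) : Type _ := HPlus H₀ →L⋆[ℂ] ℂ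

open Classical in
/-- A bounded operator `S` on `𝓗` that maps `𝓗` boundedly into `𝓗₊₁(H₀)`, regarded as an element of
`B(𝓗, 𝓗₊₁(H₀))` (and `0` if `S` is not such an operator). It is applied only to
`(H₀ - z)^{-1/2}` and its adjoint, `z ∈ ρ(H₀)`, which are such operators. -/
def toPlus (H₀ : 𝓗 →ₗ.[ℂ] 𝓗) (S : 𝓗 →L[ℂ] 𝓗) : 𝓗 →L[ℂ] HPlus H₀ :=
  if h : ∃ S' : 𝓗 →L[ℂ] HPlus H₀, ∀ f, HPlus.incl H₀ (S' f) = S f then h.choose else 0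

/-- For `S' ∈ B(𝓗, 𝓗₊₁(H₀))`, the operator `𝓗₋₁(H₀) → 𝓗` that sends `Ψ` to the vector `f_Ψ` with
`(g, f_Ψ) = Ψ(S' g)` for all `g ∈ 𝓗`, which exists by the Riesz representation theorem. -/
def rieszDual (H₀ : 𝓗 →ₗ.[ℂ] 𝓗) (S' : 𝓗 →L[ℂ] HPlus H₀) : HMinus H₀ →L[ℂ] 𝓗 :=
  LinearMap.mkContinuous
    { toFun := fun Ψ : HMinus H₀ => (InnerProductSpace.toDual ℂ 𝓗).symm
        (((starL ℂ : ℂ ≃L⋆[ℂ] ℂ) : ℂ →L⋆[ℂ] ℂ).comp (Ψ.comp S'))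
      map_add' := by
        intro Ψ Φ
        rw [← map_add]
        congr 1
        ext g
        simp
      map_smul' := by
        intro c Ψ
        apply (InnerProductSpace.toDual ℂ 𝓗).injective
        ext g
        simp [inner_smul_left] }
    ‖S'‖ (by
      intro (Ψ : HMinus H₀)
      simp only [LinearMap.coe_mk, AddHom.coe_mk, LinearIsometryEquiv.norm_map]
      refine ContinuousLinearMap.opNorm_le_bound _ (by positivity) (fun g => ?_)
      have h : ‖Ψ (S' g)‖ ≤ ‖S'‖ * ‖Ψ‖ * ‖g‖ :=
        calc ‖Ψ (S' g)‖ ≤ ‖Ψ‖ * ‖S' g‖ := Ψ.le_opNorm _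
          _ ≤ ‖Ψ‖ * (‖S'‖ * ‖g‖) := by gcongr; exact S'.le_opNorm _
          _ = ‖S'‖ * ‖Ψ‖ * ‖g‖ := by ring
      simpa using h)

theorem inner_rieszDual (H₀ : 𝓗 →ₗ.[ℂ] 𝓗) (S' : 𝓗 →L[ℂ] HPlus H₀) (Ψ : HMinus H₀) (g : 𝓗) :
    ⟪g, rieszDual H₀ S' Ψ⟫_ℂ = Ψ (S' g) := by
  rw [← inner_conj_symm]
  simp [rieszDual]

/-- The bounded operator `(H₀ - z)^{-1/2} : 𝓗 → 𝓗₊₁(H₀)`, `z ∈ ρ(H₀)`. -/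
def invSqrtPlus (H₀ : 𝓗 →ₗ.[ℂ] 𝓗) (z : ℂ) : 𝓗 →L[ℂ] HPlus H₀ :=
  toPlus H₀ (invSqrt H₀ z)

/-- The bounded extension `(H₀ - z)^{-1/2} : 𝓗₋₁(H₀) → 𝓗`, `z ∈ ρ(H₀)`: it sends `Ψ` to the vector
`f_Ψ` with `(g, f_Ψ) = Ψ(((H₀ - z)^{-1/2})^* g)` for all `g ∈ 𝓗`. For `Ψ = (·, f)` with `f ∈ 𝓗` this
is `(H₀ - z)^{-1/2} f`. -/
def invSqrtExt (H₀ : 𝓗 →ₗ.[ℂ] 𝓗) (z : ℂ) : HMinus H₀ →L[ℂ] 𝓗 :=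
  rieszDual H₀ (toPlus H₀ (ContinuousLinearMap.adjoint (invSqrt H₀ z)))

/-! ### The Birman-Schwinger operator and the operator `H` -/

/-- The Birman-Schwinger operator `A_V(z) = -(H₀ - z)^{-1/2} V (H₀ - z)^{-1/2}`, `z ∈ ρ(H₀)`. -/
def AV (H₀ : 𝓗 →ₗ.[ℂ] 𝓗) (V : HPlus H₀ →L[ℂ] HMinus H₀) (z : ℂ) : 𝓗 →L[ℂ] 𝓗 :=
  -((invSqrtExt H₀ z).comp (V.comp (invSqrtPlus H₀ z)))

/-- The set `{z ∈ ρ(H₀) | 1 ∈ ρ(A_V(z))}`. -/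
def regularSet (H₀ : 𝓗 →ₗ.[ℂ] 𝓗) (V : HPlus H₀ →L[ℂ] HMinus H₀) : Set ℂ :=
  {z | z ∈ rho H₀ ∧ (1 : ℂ) ∈ resolventSet ℂ (AV H₀ V z)}

/-- `R(z) = (H₀ - z)^{-1/2} [1 - A_V(z)]⁻¹ (H₀ - z)^{-1/2}`, for `z ∈ ρ(H₀)` with
`1 ∈ ρ(A_V(z))`. -/
def RV (H₀ : 𝓗 →ₗ.[ℂ] 𝓗) (V : HPlus H₀ →L[ℂ] HMinus H₀) (z : ℂ) : 𝓗 →L[ℂ] 𝓗 :=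
  invSqrt H₀ z * Ring.inverse (1 - AV H₀ V z) * invSqrt H₀ z

/-- The operator `H` in `𝓗` with `R(z) = (H - z)⁻¹`, that is, `H = z + R(z)⁻¹` on `ran(R(z))`. -/
def perturbedOp (H₀ : 𝓗 →ₗ.[ℂ] 𝓗) (V : HPlus H₀ →L[ℂ] HMinus H₀) (z : ℂ) : 𝓗 →ₗ.[ℂ] 𝓗 :=
  (z • LinearMap.id : 𝓗 →ₗ[ℂ] 𝓗) +ᵥ
    ((RV H₀ V z : 𝓗 →ₗ[ℂ] 𝓗).toPMap ⊤).inverse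

end Calculus

end

end BirmanSchwinger

/-! Everything is conjugated by $S=(H_0+1)^{-1/2}$ so that only bounded operators remain. For
$z\in\rho(H_0)$ the operator $N(z)=(H_0-z)^{1/2}S$ is bounded with bounded inverse $M(z)$, and
$(H_0-z)^{-1/2}=SM(z)=M(z)S$. With the single bounded operator $W=SVS$ this gives
$A_V(z)=-M(z)WM(z)$, hence $N(z)[1-A_V(z)]N(z)=D(z):=1+W-(1+z)S^2$ (`mul_one_sub_AV_mul`), formally
$S(H_0+V-z)S$, which is affine in $z$.

On $\Omega$ it follows that $R(z)=SD(z)^{-1}S$ (`RV_eq`). Since $D(z)-D(w)=(w-z)S^2$, these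
operators satisfy the resolvent identity; they are injective with dense range because $S$ is. So
they are the resolvents of one closed, densely defined $H$. Also $(\lambda-z)R(z)f=f$ holds exactly
when $f=Su$ with $D(\lambda)u=0$, that is, $f=(H_0-\lambda)^{-1/2}g$ with $g=N(\lambda)u$ fixed by
$A_V(\lambda)$ (`smul_RV_apply_eq_iff`). Compactness passes from one $A_V(z)$ to $W$ and thence to
all of them, so the Fredholm alternative gives finite multiplicities and the spectral criterion.

$S$ and $N(z)$ come from the continuous functional calculus of $B=(H_0+1)^{-1}$; `sqrtRatio` is the
symbol of $N(z)$. -/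

namespace BirmanSchwinger

noncomputable section

/-! ### The square root of a complex number in real terms -/

/-- The square root of `w` in real terms: `s` is the sign of the real part. -/
def signedSqrt (s : ℝ) (w : ℂ) : ℂ :=
  ((s * √((‖w‖ + w.re) / 2) : ℝ) : ℂ) + Complex.I * ((√((‖w‖ - w.re) / 2) : ℝ) : ℂ)

/-- The sign of `Re (λ - z)^{1/2}` for `λ ≥ 0`. -/
def branchSign (z : ℂ) : ℝ := if 0 < z.im then -1 else 1

/-- Half-angle formulas: $\theta/2\in[0,\pi]$ makes the sine nonnegative, and the cosine changes
sign at $\theta=\pi$. The branch jumps across $(0,\infty)$, but `signedSqrt s` with $s$ fixed is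
continuous on the whole plane. As $\mathrm{Im}(\lambda-z)=-\mathrm{Im}\,z$ does not depend on
$\lambda$, one sign serves all of $\sigma(H_0)$. -/
theorem csqrt_eq_signedSqrt (w : ℂ) : csqrt w = signedSqrt (if w.im < 0 then -1 else 1) w := by
  obtain ⟨θ, hθ⟩ : ∃ θ : ℝ, θ = if 0 ≤ w.arg then w.arg else w.arg + 2 * Real.pi := ⟨_, rfl⟩
  have hpi := Real.pi_pos
  have hcos : ‖w‖ * Real.cos θ = w.re := by
    have : Real.cos θ = Real.cos w.arg := by
      rw [hθ]; split_ifs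
      · rfl
      · rw [Real.cos_add_two_pi]
    rw [this, Complex.norm_mul_cos_arg]
  have h1 : (‖w‖ + w.re) / 2 = ‖w‖ * Real.cos (θ / 2) ^ 2 := by
    rw [Real.cos_sq, ← hcos]; ring_nf
  have h2 : (‖w‖ - w.re) / 2 = ‖w‖ * Real.sin (θ / 2) ^ 2 := by
    rw [Real.sin_sq, Real.cos_sq, ← hcos]; ring_nf
  have hθ0 : 0 ≤ θ := by
    rw [hθ]; split_ifs with h
    · exact h
    · linarith [Complex.neg_pi_lt_arg w]
  have hθ2 : θ ≤ 2 * Real.pi := by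
    rw [hθ]; split_ifs with h
    · linarith [Complex.arg_le_pi w]
    · linarith
  have hsin : 0 ≤ Real.sin (θ / 2) := Real.sin_nonneg_of_nonneg_of_le_pi (by linarith) (by linarith)
  have hsgn : (if w.im < 0 then -1 else 1) * |Real.cos (θ / 2)| = Real.cos (θ / 2) := by
    split_ifs with h
    · have ha : w.arg < 0 := Complex.arg_neg_iff.2 h
      rw [if_neg ha.not_ge] at hθ
      rw [abs_of_nonpos, neg_one_mul, neg_neg]
      exact Real.cos_nonpos_of_pi_div_two_le_of_le
        (by linarith [Complex.neg_pi_lt_arg w]) (by linarith)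
    · have ha : 0 ≤ w.arg := Complex.arg_nonneg_iff.2 (not_lt.1 h)
      rw [if_pos ha] at hθ
      rw [abs_of_nonneg, one_mul]
      exact Real.cos_nonneg_of_mem_Icc
        ⟨by linarith, by linarith [Complex.arg_le_pi w]⟩
  rw [signedSqrt, h1, h2, Real.sqrt_mul (norm_nonneg _), Real.sqrt_mul (norm_nonneg _),
    Real.sqrt_sq_eq_abs, Real.sqrt_sq_eq_abs, abs_of_nonneg hsin, mul_left_comm, hsgn, csqrt,
    ← hθ]
  have he : Complex.I * (θ : ℂ) / 2 = ((θ / 2 : ℝ) : ℂ) * Complex.I := by push_cast; ring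
  rw [he, Complex.exp_mul_I, ← Complex.ofReal_cos, ← Complex.ofReal_sin]
  push_cast
  ring

theorem signedSqrt_sq {s : ℝ} (hs : s ^ 2 = 1) {w : ℂ} (hw : s * |w.im| = w.im) :
    signedSqrt s w * signedSqrt s w = w := by
  have hp : 0 ≤ (‖w‖ + w.re) / 2 := by linarith [abs_le.1 (Complex.abs_re_le_norm w)]
  have hm : 0 ≤ (‖w‖ - w.re) / 2 := by linarith [abs_le.1 (Complex.abs_re_le_norm w)]
  have h1 : √((‖w‖ + w.re) / 2) * √((‖w‖ - w.re) / 2) = |w.im| / 2 := by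
    rw [← Real.sqrt_mul hp, ← Real.sqrt_sq (show 0 ≤ |w.im| / 2 by positivity)]
    congr 1
    have := Complex.sq_norm w
    rw [Complex.normSq_apply] at this
    rw [div_pow, sq_abs]
    nlinarith
  have h2 := Real.mul_self_sqrt hp
  have h3 := Real.mul_self_sqrt hm
  rw [signedSqrt]
  generalize √((‖w‖ + w.re) / 2) = p at *
  generalize √((‖w‖ - w.re) / 2) = q at *
  apply Complex.ext
  · simp
    linear_combination (s ^ 2) * h2 - h3 + ((‖w‖ + w.re) / 2) * hs
  · simp
    linear_combination 2 * s * h1 + hw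

theorem signedSqrt_real_mul (s : ℝ) {r : ℝ} (hr : 0 ≤ r) (w : ℂ) :
    signedSqrt s (r * w) = (√r : ℝ) * signedSqrt s w := by
  have h1 : (‖(r : ℂ) * w‖ + ((r : ℂ) * w).re) / 2 = r * ((‖w‖ + w.re) / 2) := by
    rw [norm_mul, Complex.norm_of_nonneg hr, Complex.re_ofReal_mul]; ring
  have h2 : (‖(r : ℂ) * w‖ - ((r : ℂ) * w).re) / 2 = r * ((‖w‖ - w.re) / 2) := by
    rw [norm_mul, Complex.norm_of_nonneg hr, Complex.re_ofReal_mul]; ring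
  rw [signedSqrt, h1, h2, Real.sqrt_mul hr, Real.sqrt_mul hr, signedSqrt]
  push_cast
  ring

theorem continuous_signedSqrt (s : ℝ) : Continuous (signedSqrt s) := by
  unfold signedSqrt
  fun_prop

/-- The function `(1 + λ)^{-1/2} (λ - z)^{1/2}` in the variable `b = (1 + λ)⁻¹`. -/
def sqrtRatio (z b : ℂ) : ℂ := signedSqrt (branchSign z) (1 - (1 + z) * b)

/-- The function `(1 + λ)^{-1/2}` in the variable `b = (1 + λ)⁻¹`. -/
def sqrtRe (b : ℂ) : ℂ := ((√b.re : ℝ) : ℂ)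

theorem continuous_sqrtRatio (z : ℂ) : Continuous (sqrtRatio z) :=
  (continuous_signedSqrt _).comp (by fun_prop)

theorem continuous_sqrtRe : Continuous sqrtRe := by
  unfold sqrtRe
  fun_prop

theorem sqrtRe_mul_self {b : ℝ} (hb : 0 ≤ b) : sqrtRe b * sqrtRe b = b := by
  rw [sqrtRe, Complex.ofReal_re, ← Complex.ofReal_mul, Real.mul_self_sqrt hb]

theorem sqrtRatio_mul_self (z : ℂ) {b : ℝ} (hb : 0 ≤ b) :
    sqrtRatio z b * sqrtRatio z b = 1 - (1 + z) * b := by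
  have him : (1 - (1 + z) * (b : ℂ)).im = -(z.im * b) := by simp
  refine signedSqrt_sq ?_ ?_
  · unfold branchSign; split_ifs <;> norm_num
  · rw [him, abs_neg, abs_mul, abs_of_nonneg hb, branchSign]
    split_ifs with h
    · rw [abs_of_pos h]; ring
    · rw [abs_of_nonpos (not_lt.1 h)]; ring

/-- With $\lambda=b^{-1}-1$ one has $1-(1+z)b=b(\lambda-z)$, and a positive factor leaves the branch
unchanged. The right side stays continuous at $b=0$, that is, at $\lambda=\infty$. -/
theorem sqrtRe_mul_csqrt (z : ℂ) {b : ℝ} (hb : 0 < b) :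
    sqrtRe b * csqrt (((b⁻¹ - 1 : ℝ) : ℂ) - z) = sqrtRatio z b := by
  have hb' : (b : ℂ) ≠ 0 := by exact_mod_cast hb.ne'
  have hw : ((b⁻¹ - 1 : ℝ) : ℂ) - z = ((b⁻¹ : ℝ) : ℂ) * (1 - (1 + z) * b) := by
    push_cast; field_simp; ring
  have hs : (if (((b⁻¹ - 1 : ℝ) : ℂ) - z).im < 0 then (-1 : ℝ) else 1) = branchSign z := by
    simp [branchSign]
  rw [csqrt_eq_signedSqrt, hs, hw, signedSqrt_real_mul _ (inv_nonneg.2 hb.le), sqrtRe, sqrtRatio,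
    ← mul_assoc, ← Complex.ofReal_mul, Complex.ofReal_re, ← Real.sqrt_mul hb.le,
    mul_inv_cancel₀ hb.ne', Real.sqrt_one, Complex.ofReal_one, one_mul]

/-! ### Functional calculus of a nonnegative bounded operator -/

section Bounded

variable {𝓗 : Type*} [NormedAddCommGroup 𝓗] [InnerProductSpace ℂ 𝓗] [CompleteSpace 𝓗]

theorem exists_nonneg_of_mem_spectrum {B : 𝓗 →L[ℂ] 𝓗} (hB : 0 ≤ B) {b : ℂ}
    (hb : b ∈ spectrum ℂ B) : ∃ r : ℝ, 0 ≤ r ∧ b = r := by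
  have h := (IsSelfAdjoint.of_nonneg hB).mem_spectrum_eq_re hb
  refine ⟨b.re, ?_, h⟩
  rw [h] at hb
  exact spectrum_nonneg_of_nonneg hB (spectrum.algebraMap_mem_iff (S := ℂ) |>.1 hb)

theorem mul_self_cfc_sqrtRe {B : 𝓗 →L[ℂ] 𝓗} (hB : 0 ≤ B) :
    cfc sqrtRe B * cfc sqrtRe B = B := by
  have hN : IsStarNormal B := (IsSelfAdjoint.of_nonneg hB).isStarNormal
  rw [← cfc_mul _ _ _ continuous_sqrtRe.continuousOn continuous_sqrtRe.continuousOn]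
  nth_rw 2 [← cfc_id' ℂ B]
  refine cfc_congr fun b hb => ?_
  obtain ⟨r, hr, rfl⟩ := exists_nonneg_of_mem_spectrum hB hb
  exact sqrtRe_mul_self hr

theorem isSelfAdjoint_cfc_sqrtRe (B : 𝓗 →L[ℂ] 𝓗) : IsSelfAdjoint (cfc sqrtRe B) := by
  rw [IsSelfAdjoint, ← cfc_star]
  congr 1
  ext b
  simp [sqrtRe]

theorem mul_self_cfc_sqrtRatio {B : 𝓗 →L[ℂ] 𝓗} (hB : 0 ≤ B) (z : ℂ) :
    cfc (sqrtRatio z) B * cfc (sqrtRatio z) B = 1 - (1 + z) • B := by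
  have hN : IsStarNormal B := (IsSelfAdjoint.of_nonneg hB).isStarNormal
  have hc := (continuous_sqrtRatio z).continuousOn (s := spectrum ℂ B)
  rw [← cfc_mul _ _ _ hc hc, ← cfc_const_mul_id (1 + z) B, ← cfc_const_one ℂ B,
    ← cfc_sub _ _ B]
  refine cfc_congr fun b hb => ?_
  obtain ⟨r, hr, rfl⟩ := exists_nonneg_of_mem_spectrum hB hb
  exact sqrtRatio_mul_self z hr

end Bounded

end

end BirmanSchwinger

namespace BirmanSchwinger

noncomputable section

variable {𝓗 : Type*} [NormedAddCommGroup 𝓗] [InnerProductSpace ℂ 𝓗]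

/-! ### Resolvents -/

theorem IsResolventAt.mem_iff {T : 𝓗 →ₗ.[ℂ] 𝓗} {z : ℂ} {R : 𝓗 →L[ℂ] 𝓗} (h : IsResolventAt T z R)
    (x w : 𝓗) : (∃ hx : x ∈ T.domain, T ⟨x, hx⟩ = w) ↔ R (w - z • x) = x := by
  constructor
  · rintro ⟨hx, rfl⟩
    exact h.2 ⟨x, hx⟩
  · intro hR
    obtain ⟨hd, hT⟩ := h.1 (w - z • x)
    have hx : x ∈ T.domain := hR ▸ hd
    refine ⟨hx, ?_⟩
    have : (⟨R (w - z • x), hd⟩ : T.domain) = ⟨x, hx⟩ := Subtype.ext hR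
    rw [this, hR] at hT
    exact sub_left_injective hT

theorem IsResolventAt.isClosed {T : 𝓗 →ₗ.[ℂ] 𝓗} {z : ℂ} {R : 𝓗 →L[ℂ] 𝓗}
    (h : IsResolventAt T z R) : T.IsClosed := by
  have : (T.graph : Set (𝓗 × 𝓗)) = {p | R (p.2 - z • p.1) = p.1} := by
    ext ⟨x, w⟩
    rw [SetLike.mem_coe, LinearPMap.mem_graph_iff, Set.mem_ofPred_eq, ← h.mem_iff]
    constructor
    · rintro ⟨y, rfl, hy⟩
      exact ⟨y.2, hy⟩
    · rintro ⟨hx, hy⟩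
      exact ⟨⟨x, hx⟩, rfl, hy⟩
  rw [LinearPMap.IsClosed, this]
  exact isClosed_eq (by fun_prop) (by fun_prop)

theorem IsResolventAt.mem_eigenspace_iff {T : 𝓗 →ₗ.[ℂ] 𝓗} {z : ℂ} {R : 𝓗 →L[ℂ] 𝓗}
    (h : IsResolventAt T z R) (l : ℂ) (f : 𝓗) :
    f ∈ eigenspace T l ↔ (l - z) • R f = f := by
  rw [BirmanSchwinger.mem_eigenspace_iff, h.mem_iff, ← sub_smul, map_smul]

theorem eigenspace_eq_bot {T : 𝓗 →ₗ.[ℂ] 𝓗} {z : ℂ} (hz : z ∈ rho T) : eigenspace T z = ⊥ := by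
  obtain ⟨R, hR⟩ := hz
  rw [eq_bot_iff]
  intro f hf
  rw [hR.mem_eigenspace_iff, sub_self, zero_smul] at hf
  exact hf.symm

theorem isResolventAt_resolventOp {T : 𝓗 →ₗ.[ℂ] 𝓗} {z : ℂ} (hz : z ∈ rho T) :
    IsResolventAt T z (resolventOp T z) := by
  have h : ∃ R : 𝓗 →L[ℂ] 𝓗, IsResolventAt T z R := hz
  rw [resolventOp, dif_pos h]
  exact h.choose_spec

variable {H₀ : 𝓗 →ₗ.[ℂ] 𝓗}

/-! ### The resolvent of a nonnegative self-adjoint operator at -1 -/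

theorem norm_le_norm_add_of_nonneg
    (hnonneg : ∀ x : H₀.domain, 0 ≤ (inner ℂ (x : 𝓗) (H₀ x)).re) (x : H₀.domain) :
    ‖(x : 𝓗)‖ ≤ ‖H₀ x + x‖ := by
  rcases eq_or_ne (‖(x : 𝓗)‖) 0 with h0 | h0
  · rw [h0]; exact norm_nonneg _
  · have h1 : ‖(x : 𝓗)‖ ^ 2 ≤ (⟪(x : 𝓗), H₀ x + x⟫_ℂ).re := by
      rw [inner_add_right, Complex.add_re]
      have h : (⟪(x : 𝓗), (x : 𝓗)⟫_ℂ).re = ‖(x : 𝓗)‖ ^ 2 := inner_self_eq_norm_sq (𝕜 := ℂ) _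
      linarith [hnonneg x]
    have h2 : (⟪(x : 𝓗), H₀ x + x⟫_ℂ).re ≤ ‖(x : 𝓗)‖ * ‖H₀ x + x‖ :=
      (Complex.re_le_norm _).trans (norm_inner_le_norm _ _)
    have h3 : 0 < ‖(x : 𝓗)‖ := lt_of_le_of_ne (norm_nonneg _) h0.symm
    nlinarith

theorem resolventOp_neg_one_apply (hρ : (-1 : ℂ) ∈ rho H₀) (y : 𝓗) :
    ∃ h : resolventOp H₀ (-1) y ∈ H₀.domain,
      H₀ ⟨resolventOp H₀ (-1) y, h⟩ + resolventOp H₀ (-1) y = y := by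
  obtain ⟨h, h'⟩ := (isResolventAt_resolventOp hρ).1 y
  exact ⟨h, by simpa using h'⟩

theorem resolventOp_injective (hρ : (-1 : ℂ) ∈ rho H₀) {y : 𝓗} (hy : resolventOp H₀ (-1) y = 0) :
    y = 0 := by
  obtain ⟨h, h'⟩ := resolventOp_neg_one_apply hρ y
  have h0 : (⟨resolventOp H₀ (-1) y, h⟩ : H₀.domain) = 0 := Subtype.ext hy
  rw [h0, H₀.map_zero, hy, add_zero] at h'
  exact h'.symm

/-- The operator is $(H_0-z)(H_0+1)^{-1}$; the resolvent identity shows that its inverse is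
$1+(1+z)R_0(z)$. -/
theorem isUnit_one_sub_smul_resolventOp (hρ : (-1 : ℂ) ∈ rho H₀) {z : ℂ} (hz : z ∈ rho H₀) :
    IsUnit (1 - (1 + z) • resolventOp H₀ (-1)) := by
  obtain ⟨R, hR⟩ := hz
  have hB := isResolventAt_resolventOp hρ
  generalize resolventOp H₀ (-1) = B at hB
  have h1 : ∀ y, R y = B y + (1 + z) • B (R y) := fun y => by
    obtain ⟨h, h'⟩ := hR.1 y
    have := hB.2 ⟨R y, h⟩
    have e : H₀ ⟨R y, h⟩ - (-1 : ℂ) • R y = y + (1 + z) • R y := by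
      linear_combination (norm := module) h'
    rw [e, map_add, map_smul] at this
    exact this.symm
  have h2 : ∀ y, B y = R y - (1 + z) • R (B y) := fun y => by
    obtain ⟨h, h'⟩ := hB.1 y
    have := hR.2 ⟨B y, h⟩
    have e : H₀ ⟨B y, h⟩ - z • B y = y - (1 + z) • B y := by
      linear_combination (norm := module) h'
    rw [e, map_sub, map_smul] at this
    exact this.symm
  refine ⟨⟨1 - (1 + z) • B, 1 + (1 + z) • R, ?_, ?_⟩, rfl⟩
  · ext y
    have := h1 y
    simp
    linear_combination (norm := module) (1 + z) • this
  · ext y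
    have := h2 y
    simp
    linear_combination (norm := module) -(1 + z) • this

variable [CompleteSpace 𝓗]

theorem inner_apply_eq_of_isSelfAdjoint (hsa : IsSelfAdjoint H₀) (x y : H₀.domain) :
    ⟪H₀ x, (y : 𝓗)⟫_ℂ = ⟪(x : 𝓗), H₀ y⟫_ℂ := by
  have h := LinearPMap.adjoint_isFormalAdjoint hsa.dense_domain
  rw [LinearPMap.isSelfAdjoint_def.1 hsa] at h
  exact h x y

/-- The bound $\|x\|\le\|(H_0+1)x\|$ and the closed graph make the range of $H_0+1$ closed. A vector
$u$ orthogonal to it lies in $\mathrm{dom}(H_0^*)=\mathrm{dom}(H_0)$ with $H_0u=-u$, and the same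
bound forces $u=0$. -/
theorem exists_apply_add_eq (hsa : IsSelfAdjoint H₀)
    (hnonneg : ∀ x : H₀.domain, 0 ≤ (inner ℂ (x : 𝓗) (H₀ x)).re) (y : 𝓗) :
    ∃ x : H₀.domain, H₀ x + x = y := by
  let f : H₀.graph →L[ℂ] 𝓗 :=
    (ContinuousLinearMap.snd ℂ 𝓗 𝓗 + ContinuousLinearMap.fst ℂ 𝓗 𝓗).comp H₀.graph.subtypeL
  have hf : ∀ p : H₀.graph, f p = p.1.2 + p.1.1 := fun p => rfl
  have hx : ∀ p : H₀.graph, ∃ x : H₀.domain, p.1 = ((x : 𝓗), H₀ x) := fun p => by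
    obtain ⟨x, h1, h2⟩ := LinearPMap.mem_graph_iff _ |>.1 p.2
    exact ⟨x, Prod.ext h1.symm h2.symm⟩
  have hbound : ∀ p : H₀.graph, ‖p‖ ≤ (2 : NNReal) * ‖f p‖ := fun p => by
    obtain ⟨x, hp⟩ := hx p
    have h1 := norm_le_norm_add_of_nonneg hnonneg x
    have h2 : ‖H₀ x‖ ≤ ‖H₀ x + x‖ + ‖(x : 𝓗)‖ := by
      simpa using norm_sub_le (H₀ x + x) (x : 𝓗)
    rw [hf, Submodule.coe_norm, hp, Prod.norm_def, NNReal.coe_ofNat]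
    exact max_le (by linarith [norm_nonneg (H₀ x + x)]) (by linarith)
  have hcl : IsClosed (H₀.graph : Set (𝓗 × 𝓗)) := hsa.isClosed
  have : CompleteSpace H₀.graph := hcl.completeSpace_coe
  have hran : IsClosed (f.range : Set 𝓗) :=
    (f.antilipschitz_of_bound hbound).isClosed_range f.uniformContinuous
  have : CompleteSpace f.range := hran.completeSpace_coe
  have htop : f.range = ⊤ := by
    rw [← Submodule.orthogonal_eq_bot_iff, eq_bot_iff]
    intro u hu
    have hu' : ∀ x : H₀.domain, ⟪-u, (x : 𝓗)⟫_ℂ = ⟪u, H₀ x⟫_ℂ := fun x => by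
      have h := (Submodule.mem_orthogonal' _ _).1 hu (f ⟨(x, H₀ x), H₀.mem_graph x⟩) ⟨_, rfl⟩
      rw [hf, inner_add_right] at h
      rw [inner_neg_left]
      linear_combination -h
    have hmem : u ∈ H₀.domain := by
      rw [← LinearPMap.isSelfAdjoint_def.1 hsa]
      exact LinearPMap.mem_adjoint_domain_of_exists _ ⟨-u, hu'⟩
    have happ : H₀ ⟨u, hmem⟩ = -u := by
      refine hsa.dense_domain.eq_of_inner_left ℂ fun v hv => ?_
      rw [hu' ⟨v, hv⟩]
      exact inner_apply_eq_of_isSelfAdjoint hsa ⟨u, hmem⟩ ⟨v, hv⟩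
    have h := norm_le_norm_add_of_nonneg hnonneg ⟨u, hmem⟩
    simpa [happ] using h
  obtain ⟨p, hp⟩ : y ∈ f.range := htop ▸ Submodule.mem_top
  obtain ⟨x, hpx⟩ := hx p
  refine ⟨x, ?_⟩
  rw [← hp]
  change _ = f p
  rw [hf, hpx]

theorem neg_one_mem_rho (hsa : IsSelfAdjoint H₀)
    (hnonneg : ∀ x : H₀.domain, 0 ≤ (inner ℂ (x : 𝓗) (H₀ x)).re) : (-1 : ℂ) ∈ rho H₀ := by
  choose g hg using exists_apply_add_eq hsa hnonneg
  have hinj : ∀ x x' : H₀.domain, H₀ x + x = H₀ x' + x' → x = x' := fun x x' h => by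
    have h1 := norm_le_norm_add_of_nonneg hnonneg (x - x')
    have h2 : H₀ (x - x') + ((x - x' : H₀.domain) : 𝓗) = 0 := by
      rw [H₀.map_sub, Submodule.coe_sub, sub_add_sub_comm, h, sub_self]
    rw [h2, norm_zero] at h1
    exact sub_eq_zero.1 (Subtype.ext (norm_le_zero_iff.1 h1))
  let R : 𝓗 →L[ℂ] 𝓗 := LinearMap.mkContinuous
    { toFun := fun y => (g y : 𝓗)
      map_add' := fun y y' => by
        rw [← Submodule.coe_add]
        congr 1
        apply hinj
        rw [hg, H₀.map_add, Submodule.coe_add, add_add_add_comm, hg, hg]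
      map_smul' := fun c y => by
        rw [RingHom.id_apply, ← Submodule.coe_smul]
        congr 1
        apply hinj
        rw [hg, H₀.map_smul, Submodule.coe_smul, ← smul_add, hg] } 1 fun y => by
      have := norm_le_norm_add_of_nonneg hnonneg (g y)
      rw [hg] at this
      simpa using this
  have hR : ∀ y, R y = g y := fun y => rfl
  refine ⟨R, fun y => ⟨(g y).2, ?_⟩, fun x => ?_⟩
  · have := hg y
    simpa [hR] using this
  · rw [hR]
    congr 1
    apply hinj
    rw [hg]
    simp

theorem resolventOp_neg_one_nonneg (hsa : IsSelfAdjoint H₀)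
    (hnonneg : ∀ x : H₀.domain, 0 ≤ (inner ℂ (x : 𝓗) (H₀ x)).re) :
    0 ≤ resolventOp H₀ (-1) := by
  have happ := resolventOp_neg_one_apply (neg_one_mem_rho hsa hnonneg)
  rw [ContinuousLinearMap.nonneg_iff_isPositive]
  refine ⟨fun u v => ?_, fun u => ?_⟩
  · obtain ⟨hu, hu'⟩ := happ u
    obtain ⟨hv, hv'⟩ := happ v
    change ⟪resolventOp H₀ (-1) u, v⟫_ℂ = ⟪u, resolventOp H₀ (-1) v⟫_ℂ
    conv_lhs => rw [← hv']
    conv_rhs => rw [← hu']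
    rw [inner_add_left, inner_add_right]
    congr 1
    exact (inner_apply_eq_of_isSelfAdjoint hsa ⟨_, hu⟩ ⟨_, hv⟩).symm
  · obtain ⟨hu, hu'⟩ := happ u
    change 0 ≤ (⟪resolventOp H₀ (-1) u, u⟫_ℂ).re
    nth_rw 2 [← hu']
    rw [inner_add_right, Complex.add_re]
    exact add_nonneg (hnonneg ⟨_, hu⟩) (inner_self_nonneg (𝕜 := ℂ))

/-! ### Functions of `H₀` -/

theorem boundedFun_csqrt_div (hB : 0 ≤ resolventOp H₀ (-1)) (z : ℂ) :
    boundedFun H₀ (fun t => csqrt (t - z) / (1 + t)) =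
      cfc sqrtRe (resolventOp H₀ (-1)) * cfc (sqrtRatio z) (resolventOp H₀ (-1)) := by
  rw [boundedFun, ← cfc_mul _ _ _ continuous_sqrtRe.continuousOn
    (continuous_sqrtRatio z).continuousOn]
  refine cfc_congr fun b hb => ?_
  obtain ⟨r, hr, rfl⟩ := exists_nonneg_of_mem_spectrum hB hb
  rcases hr.eq_or_lt with rfl | hr
  -- At $b=0$ the prescribed value $0$ agrees with the product, since `sqrtRe` vanishes there.
  · simp [sqrtRe]
  · have hr' : (r : ℂ) ≠ 0 := by exact_mod_cast hr.ne'
    have h := sqrtRe_mul_csqrt z hr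
    have h2 := sqrtRe_mul_self hr.le
    rw [← Complex.ofReal_inv, Complex.ofReal_re, if_neg hr', ← h, ← mul_assoc, h2]
    push_cast
    field_simp
    ring_nf

/-- A zero at $b=r$ means $r(1+z)=1$, so $r-B=r(1-(1+z)B)$ would be invertible although
$r\in\sigma(B)$. -/
theorem sqrtRatio_ne_zero (hB : 0 ≤ resolventOp H₀ (-1)) {z : ℂ}
    (hu : IsUnit (1 - (1 + z) • resolventOp H₀ (-1))) {b : ℂ}
    (hb : b ∈ spectrum ℂ (resolventOp H₀ (-1))) : sqrtRatio z b ≠ 0 := by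
  obtain ⟨r, hr, rfl⟩ := exists_nonneg_of_mem_spectrum hB hb
  intro h0
  have h1 := sqrtRatio_mul_self z hr
  rw [h0, zero_mul] at h1
  have hr0 : (r : ℂ) ≠ 0 := by
    intro h; rw [h] at h1; simp at h1
  refine hb (?_ : IsUnit _)
  have h2 : algebraMap ℂ (𝓗 →L[ℂ] 𝓗) r - resolventOp H₀ (-1) =
      algebraMap ℂ (𝓗 →L[ℂ] 𝓗) r * (1 - (1 + z) • resolventOp H₀ (-1)) := by
    have h3 : (r : ℂ) * (1 + z) = 1 := by linear_combination h1
    rw [mul_sub, mul_one, Algebra.algebraMap_eq_smul_one, smul_mul_assoc, one_mul, smul_smul, h3,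
      one_smul]
  rw [h2]
  exact ((IsUnit.mk0 _ hr0).map (algebraMap ℂ (𝓗 →L[ℂ] 𝓗))).mul hu

/-- On $\sigma(B)$ the symbol of `invSqrt` is the quotient of `sqrtRe` by the nonvanishing
`sqrtRatio z`. It is therefore continuous, as multiplicativity of the calculus requires. -/
theorem invSqrt_mul_cfc (hB : 0 ≤ resolventOp H₀ (-1)) {z : ℂ}
    (hu : IsUnit (1 - (1 + z) • resolventOp H₀ (-1))) :
    invSqrt H₀ z * cfc (sqrtRatio z) (resolventOp H₀ (-1)) =
      cfc sqrtRe (resolventOp H₀ (-1)) := by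
  have hinv : invSqrt H₀ z =
      cfc (fun b => sqrtRe b * (sqrtRatio z b)⁻¹) (resolventOp H₀ (-1)) := by
    refine cfc_congr fun b hb => ?_
    have hne := sqrtRatio_ne_zero hB hu hb
    obtain ⟨r, hr, rfl⟩ := exists_nonneg_of_mem_spectrum hB hb
    rcases hr.eq_or_lt with rfl | hr
    · simp [sqrtRe]
    · have hr' : (r : ℂ) ≠ 0 := by exact_mod_cast hr.ne'
      have h := sqrtRe_mul_csqrt z hr
      simp only
      rw [← Complex.ofReal_inv, Complex.ofReal_re, if_neg hr', ← h]
      rw [← h] at hne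
      have h1 := left_ne_zero_of_mul hne
      have h2 := right_ne_zero_of_mul hne
      field_simp
  have hc : ContinuousOn (fun b => sqrtRe b * (sqrtRatio z b)⁻¹)
      (spectrum ℂ (resolventOp H₀ (-1))) :=
    continuous_sqrtRe.continuousOn.mul
      ((continuous_sqrtRatio z).continuousOn.inv₀ fun b hb => sqrtRatio_ne_zero hB hu hb)
  rw [hinv, ← cfc_mul _ _ _ hc (continuous_sqrtRatio z).continuousOn]
  refine cfc_congr fun b hb => ?_
  exact inv_mul_cancel_right₀ (sqrtRatio_ne_zero hB hu hb) _

theorem isUnit_cfc_sqrtRatio (hB : 0 ≤ resolventOp H₀ (-1)) {z : ℂ}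
    (hu : IsUnit (1 - (1 + z) • resolventOp H₀ (-1))) :
    IsUnit (cfc (sqrtRatio z) (resolventOp H₀ (-1))) := by
  rw [← mul_self_cfc_sqrtRatio hB z] at hu
  exact ((Commute.refl _).isUnit_mul_iff.1 hu).1

/-- `(H₀ - z)^{1/2}` maps `(H₀ + 1)^{-1/2} g` to `(H₀ - z)^{1/2} (H₀ + 1)^{-1/2} g`. -/
theorem sqrtOp_apply_cfc_sqrtRe (hρ : (-1 : ℂ) ∈ rho H₀) (hB : 0 ≤ resolventOp H₀ (-1)) (z : ℂ)
    (g : 𝓗) : ∃ h : cfc sqrtRe (resolventOp H₀ (-1)) g ∈ (sqrtOp H₀ z).domain,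
      sqrtOp H₀ z ⟨cfc sqrtRe (resolventOp H₀ (-1)) g, h⟩ =
        cfc (sqrtRatio z) (resolventOp H₀ (-1)) g := by
  have hC : boundedFun H₀ (fun t => csqrt (t - z) / (1 + t))
      (cfc sqrtRe (resolventOp H₀ (-1)) g) =
        resolventOp H₀ (-1) (cfc (sqrtRatio z) (resolventOp H₀ (-1)) g) := by
    rw [boundedFun_csqrt_div hB]
    change (cfc sqrtRe (resolventOp H₀ (-1)) * cfc (sqrtRatio z) (resolventOp H₀ (-1)) *
      cfc sqrtRe (resolventOp H₀ (-1))) g = _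
    rw [mul_assoc, (cfc_commute_cfc (sqrtRatio z) sqrtRe (resolventOp H₀ (-1))).eq, ← mul_assoc,
      mul_self_cfc_sqrtRe hB]
    rfl
  obtain ⟨h, h'⟩ := resolventOp_neg_one_apply hρ (cfc (sqrtRatio z) (resolventOp H₀ (-1)) g)
  have hmem : boundedFun H₀ (fun t => csqrt (t - z) / (1 + t))
      (cfc sqrtRe (resolventOp H₀ (-1)) g) ∈ H₀.domain := hC ▸ h
  refine ⟨hmem, ?_⟩
  have e : (⟨_, hmem⟩ : H₀.domain) = ⟨_, h⟩ := Subtype.ext hC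
  change H₀ ⟨_, hmem⟩ + boundedFun H₀ (fun t => csqrt (t - z) / (1 + t))
    (cfc sqrtRe (resolventOp H₀ (-1)) g) = _
  rw [e, hC, h']

end

end BirmanSchwinger

namespace BirmanSchwinger

noncomputable section

variable {𝓗 : Type*} [NormedAddCommGroup 𝓗] [InnerProductSpace ℂ 𝓗]

/-! ### Operators recovered from their resolvents -/

theorem isResolventAt_vadd_inverse {R : 𝓗 →L[ℂ] 𝓗} (hR : ∀ y, R y = 0 → y = 0) (z : ℂ) :
    IsResolventAt ((z • LinearMap.id : 𝓗 →ₗ[ℂ] 𝓗) +ᵥ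
      ((R : 𝓗 →ₗ[ℂ] 𝓗).toPMap ⊤).inverse) z R := by
  have hker : LinearMap.ker ((R : 𝓗 →ₗ[ℂ] 𝓗).toPMap ⊤).toFun = ⊥ :=
    LinearMap.ker_eq_bot'.2 fun m hm => Subtype.ext (hR m hm)
  have key : ∀ y : 𝓗, ∃ h : R y ∈ ((R : 𝓗 →ₗ[ℂ] 𝓗).toPMap ⊤).inverse.domain,
      ((R : 𝓗 →ₗ[ℂ] 𝓗).toPMap ⊤).inverse ⟨R y, h⟩ = y := fun y => by
    have h : R y ∈ ((R : 𝓗 →ₗ[ℂ] 𝓗).toPMap ⊤).inverse.domain := by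
      rw [LinearPMap.inverse_domain]
      exact ⟨⟨y, Submodule.mem_top⟩, rfl⟩
    exact ⟨h, LinearPMap.inverse_apply_eq hker (x := ⟨y, Submodule.mem_top⟩) rfl⟩
  refine ⟨fun y => ?_, fun x => ?_⟩
  · obtain ⟨h, hy⟩ := key y
    refine ⟨h, ?_⟩
    change (z • R y + ((R : 𝓗 →ₗ[ℂ] 𝓗).toPMap ⊤).inverse ⟨R y, h⟩) - z • R y = y
    rw [hy]
    abel
  · obtain ⟨x, hx⟩ := x
    have hx' : x ∈ ((R : 𝓗 →ₗ[ℂ] 𝓗).toPMap ⊤).inverse.domain := hx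
    rw [LinearPMap.inverse_domain] at hx'
    obtain ⟨⟨y, hy⟩, hxy⟩ := hx'
    have hxy' : R y = x := hxy
    subst hxy'
    obtain ⟨h, hy'⟩ := key y
    change R ((z • R y + ((R : 𝓗 →ₗ[ℂ] 𝓗).toPMap ⊤).inverse ⟨R y, h⟩) - z • R y) = R y
    rw [hy', add_sub_cancel_left]

/-- The identity with $RQ$ puts $\mathrm{ran}\,Q$ into the domain and makes $Q$ a right inverse of
$T-w$; the one with $QR$ makes it a left inverse. -/
theorem IsResolventAt.of_resolvent_identity {T : 𝓗 →ₗ.[ℂ] 𝓗} {z w : ℂ} {R Q : 𝓗 →L[ℂ] 𝓗}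
    (h : IsResolventAt T z R) (h1 : Q - R = (w - z) • (R * Q)) (h2 : Q - R = (w - z) • (Q * R)) :
    IsResolventAt T w Q := by
  have h1' : ∀ y, Q y - R y = (w - z) • R (Q y) := fun y => congrArg (fun F => F y) h1
  have h2' : ∀ y, Q y - R y = (w - z) • Q (R y) := fun y => congrArg (fun F => F y) h2
  refine ⟨fun y => ?_, fun x => ?_⟩
  · obtain ⟨hd, hT⟩ := (h.mem_iff (Q y) (y + w • Q y)).2 (by
      rw [add_sub_assoc, ← sub_smul, map_add, map_smul, ← h1', add_sub_cancel])
    exact ⟨hd, by rw [hT, add_sub_cancel_right]⟩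
  · have hx := h.2 x
    have e : T x - w • (x : 𝓗) = (T x - z • (x : 𝓗)) - (w - z) • (x : 𝓗) := by module
    have := h2' (T x - z • (x : 𝓗))
    rw [hx] at this
    rw [e, map_sub, map_smul, ← this]
    abel

variable [CompleteSpace 𝓗] {H₀ : 𝓗 →ₗ.[ℂ] 𝓗}

/-! ### Lifting to `𝓗₊₁` -/

theorem HPlus.norm_sq_eq (f : HPlus H₀) :
    ‖f‖ ^ 2 = ‖HPlus.sqrtMap H₀ f‖ ^ 2 + ‖HPlus.incl H₀ f‖ ^ 2 := by
  rw [← inner_self_eq_norm_sq (𝕜 := ℂ) f, ← inner_self_eq_norm_sq (𝕜 := ℂ) (HPlus.sqrtMap H₀ f),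
    ← inner_self_eq_norm_sq (𝕜 := ℂ) (HPlus.incl H₀ f), ← map_add]
  rfl

theorem incl_toPlus {T : 𝓗 →L[ℂ] 𝓗} (h : ∃ T' : 𝓗 →L[ℂ] HPlus H₀, ∀ f, HPlus.incl H₀ (T' f) = T f)
    (f : 𝓗) : HPlus.incl H₀ (toPlus H₀ T f) = T f := by
  rw [toPlus, dif_pos h]
  exact h.choose_spec f

theorem toPlus_eq {T : 𝓗 →L[ℂ] 𝓗} {T' : 𝓗 →L[ℂ] HPlus H₀}
    (h : ∀ f, HPlus.incl H₀ (T' f) = T f) : toPlus H₀ T = T' := by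
  ext f
  apply HPlus.incl_injective
  rw [incl_toPlus ⟨T', h⟩, h]

/-- $H_0^{1/2}S=N(0)$ is bounded, so both terms of the $\mathcal H_{+1}$ norm of $Sf$ are controlled
by $\|f\|$. -/
theorem exists_lift_cfc_sqrtRe (hρ : (-1 : ℂ) ∈ rho H₀) (hB : 0 ≤ resolventOp H₀ (-1)) :
    ∃ S' : 𝓗 →L[ℂ] HPlus H₀, ∀ f,
      HPlus.incl H₀ (S' f) = cfc sqrtRe (resolventOp H₀ (-1)) f := by
  have key := sqrtOp_apply_cfc_sqrtRe hρ hB 0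
  generalize cfc sqrtRe (resolventOp H₀ (-1)) = S at key
  generalize cfc (sqrtRatio 0) (resolventOp H₀ (-1)) = N at key
  choose hmem hval using key
  let L : 𝓗 →ₗ[ℂ] HPlus H₀ := LinearMap.codRestrict (sqrtOp H₀ 0).domain (S : 𝓗 →ₗ[ℂ] 𝓗) hmem
  have hL : ∀ f, HPlus.incl H₀ (L f) = S f := fun f => rfl
  have hL' : ∀ f, HPlus.sqrtMap H₀ (L f) = N f := hval
  refine ⟨L.mkContinuous (‖N‖ + ‖S‖) fun f => ?_, hL⟩
  refine le_of_sq_le_sq ?_ (by positivity)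
  rw [HPlus.norm_sq_eq, hL, hL']
  have h1 := N.le_opNorm f
  have h2 := S.le_opNorm f
  have h3 : 0 ≤ (‖N‖ * ‖f‖) * (‖S‖ * ‖f‖) := by positivity
  have h4 := pow_le_pow_left₀ (norm_nonneg _) h1 2
  have h5 := pow_le_pow_left₀ (norm_nonneg _) h2 2
  nlinarith

/-! ### Factorization of the Birman-Schwinger operator -/

/-- With `S = (H₀ + 1)^{-1/2}`, `N z = (H₀ - z)^{1/2} (H₀ + 1)^{-1/2}`, its inverse `M z`, and
`W = S V S`, the properties used below. -/
structure IsFactorization (H₀ : 𝓗 →ₗ.[ℂ] 𝓗) (V : HPlus H₀ →L[ℂ] HMinus H₀)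
    (S W : 𝓗 →L[ℂ] 𝓗) (N M : ℂ → 𝓗 →L[ℂ] 𝓗) : Prop where
  isSelfAdjoint : IsSelfAdjoint S
  eq_zero : ∀ y, S y = 0 → y = 0
  inv_mul : ∀ z ∈ rho H₀, M z * N z = 1
  mul_inv : ∀ z ∈ rho H₀, N z * M z = 1
  mul_self : ∀ z ∈ rho H₀, N z * N z = 1 - (1 + z) • (S * S)
  invSqrt_eq : ∀ z ∈ rho H₀, invSqrt H₀ z = S * M z
  invSqrt_eq' : ∀ z ∈ rho H₀, invSqrt H₀ z = M z * S
  AV_eq : ∀ z ∈ rho H₀, AV H₀ V z = -(M z * W * M z)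
  sqrtOp_apply : ∀ z ∈ rho H₀, ∀ g, ∃ h : S g ∈ (sqrtOp H₀ z).domain,
    sqrtOp H₀ z ⟨S g, h⟩ = N z g

theorem exists_isFactorization (hsa : IsSelfAdjoint H₀)
    (hnonneg : ∀ x : H₀.domain, 0 ≤ (inner ℂ (x : 𝓗) (H₀ x)).re)
    (V : HPlus H₀ →L[ℂ] HMinus H₀) :
    ∃ (S W : 𝓗 →L[ℂ] 𝓗) (N M : ℂ → 𝓗 →L[ℂ] 𝓗), IsFactorization H₀ V S W N M := by
  have hρ := neg_one_mem_rho hsa hnonneg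
  have hB := resolventOp_neg_one_nonneg hsa hnonneg
  obtain ⟨S', hS'⟩ := exists_lift_cfc_sqrtRe hρ hB
  set S := cfc sqrtRe (resolventOp H₀ (-1)) with hSdef
  set N : ℂ → 𝓗 →L[ℂ] 𝓗 := fun z => cfc (sqrtRatio z) (resolventOp H₀ (-1)) with hNdef
  have hSS : S * S = resolventOp H₀ (-1) := mul_self_cfc_sqrtRe hB
  have hSsa : IsSelfAdjoint S := isSelfAdjoint_cfc_sqrtRe _
  have hu : ∀ z ∈ rho H₀, IsUnit (1 - (1 + z) • resolventOp H₀ (-1)) := fun z hz =>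
    isUnit_one_sub_smul_resolventOp hρ hz
  have hN : ∀ z ∈ rho H₀, IsUnit (N z) := fun z hz => isUnit_cfc_sqrtRatio hB (hu z hz)
  set M : ℂ → 𝓗 →L[ℂ] 𝓗 := fun z => Ring.inverse (N z) with hMdef
  have hMN : ∀ z ∈ rho H₀, M z * N z = 1 := fun z hz => Ring.inverse_mul_cancel _ (hN z hz)
  have hNM : ∀ z ∈ rho H₀, N z * M z = 1 := fun z hz => Ring.mul_inverse_cancel _ (hN z hz)
  have hcomm : ∀ z, S * N z = N z * S := fun z => cfc_commute_cfc _ _ _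
  have hI : ∀ z ∈ rho H₀, invSqrt H₀ z = S * M z := fun z hz => by
    have h : invSqrt H₀ z * N z = S := invSqrt_mul_cfc hB (hu z hz)
    rw [← h, mul_assoc, hNM z hz, mul_one]
  have hI' : ∀ z ∈ rho H₀, invSqrt H₀ z = M z * S := fun z hz => by
    rw [hI z hz]
    calc S * M z = M z * N z * S * M z := by rw [hMN z hz, one_mul]
      _ = M z * (S * N z) * M z := by rw [hcomm]; simp only [mul_assoc]
      _ = M z * S := by rw [mul_assoc, mul_assoc, hNM z hz, mul_one]
  refine ⟨S, (rieszDual H₀ S').comp (V.comp S'), N, M, hSsa, fun y hy => ?_, hMN, hNM,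
    fun z _ => ?_, hI, hI', fun z hz => ?_, fun z _ g => sqrtOp_apply_cfc_sqrtRe hρ hB z g⟩
  · apply resolventOp_injective hρ
    rw [← hSS, mul_apply_eq_comp, hy, map_zero]
  · rw [hSS]
    exact mul_self_cfc_sqrtRatio hB z
  · have h1 : invSqrtPlus H₀ z = S'.comp (M z) := toPlus_eq fun f => by
      rw [hI z hz]
      exact hS' (M z f)
    -- The order $M(z)S$ is needed here: its adjoint $SM(z)^*$ again factors through the lift of
    -- $S$.
    have h2 : toPlus H₀ (ContinuousLinearMap.adjoint (invSqrt H₀ z)) =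
        S'.comp (ContinuousLinearMap.adjoint (M z)) := toPlus_eq fun f => by
      have h : ContinuousLinearMap.adjoint (invSqrt H₀ z) =
          S * ContinuousLinearMap.adjoint (M z) := by
        rw [hI' z hz, ← ContinuousLinearMap.star_eq_adjoint, star_mul, hSsa.star_eq,
          ContinuousLinearMap.star_eq_adjoint]
      rw [h]
      exact hS' _
    ext f
    refine ext_inner_left ℂ fun g => ?_
    rw [AV, invSqrtExt, h1, h2, neg_apply, neg_apply,
      inner_neg_right, inner_neg_right]
    congr 1
    change ⟪g, rieszDual H₀ _ (V (S' (M z f)))⟫_ℂ =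
      ⟪g, M z (rieszDual H₀ S' (V (S' (M z f))))⟫_ℂ
    rw [inner_rieszDual, ← ContinuousLinearMap.adjoint_inner_left, inner_rieszDual]
    rfl

namespace IsFactorization

variable {V : HPlus H₀ →L[ℂ] HMinus H₀} {S W : 𝓗 →L[ℂ] 𝓗} {N M : ℂ → 𝓗 →L[ℂ] 𝓗}
  (F : IsFactorization H₀ V S W N M)

include F

theorem mul_one_sub_AV_mul {z : ℂ} (hz : z ∈ rho H₀) :
    N z * (1 - AV H₀ V z) * N z = 1 + W - (1 + z) • (S * S) := by
  rw [F.AV_eq z hz, sub_neg_eq_add, mul_add, add_mul, mul_one, F.mul_self z hz,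
    show N z * (M z * W * M z) * N z = (N z * M z) * W * (M z * N z) by simp only [mul_assoc],
    F.mul_inv z hz, F.inv_mul z hz, one_mul, mul_one]
  abel

theorem isUnit_N {z : ℂ} (hz : z ∈ rho H₀) : IsUnit (N z) :=
  ⟨⟨N z, M z, F.mul_inv z hz, F.inv_mul z hz⟩, rfl⟩

theorem isUnit_of_mem {z : ℂ} (hz : z ∈ regularSet H₀ V) :
    IsUnit (1 + W - (1 + z) • (S * S)) := by
  have h : IsUnit (1 - AV H₀ V z) := by
    simpa [spectrum.mem_resolventSet_iff] using hz.2
  rw [← F.mul_one_sub_AV_mul hz.1]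
  exact ((F.isUnit_N hz.1).mul h).mul (F.isUnit_N hz.1)

theorem RV_eq {z : ℂ} (hz : z ∈ regularSet H₀ V) :
    RV H₀ V z = S * Ring.inverse (1 + W - (1 + z) • (S * S)) * S := by
  have hA : IsUnit (1 - AV H₀ V z) := by
    simpa [spectrum.mem_resolventSet_iff] using hz.2
  have hD := F.isUnit_of_mem hz
  have h := F.mul_one_sub_AV_mul hz.1
  generalize 1 + W - (1 + z) • (S * S) = D at hD h
  have hinv : Ring.inverse (1 - AV H₀ V z) = N z * Ring.inverse D * N z := by
    have h1 : (1 - AV H₀ V z) * (N z * Ring.inverse D * N z) = 1 := by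
      calc (1 - AV H₀ V z) * (N z * Ring.inverse D * N z)
          = M z * N z * (1 - AV H₀ V z) * (N z * Ring.inverse D * N z) := by
            rw [F.inv_mul z hz.1, one_mul]
        _ = M z * (N z * (1 - AV H₀ V z) * N z * Ring.inverse D) * N z := by
            simp only [mul_assoc]
        _ = 1 := by rw [h, Ring.mul_inverse_cancel _ hD, mul_one, F.inv_mul z hz.1]
    calc Ring.inverse (1 - AV H₀ V z)
        = Ring.inverse (1 - AV H₀ V z) * ((1 - AV H₀ V z) * (N z * Ring.inverse D * N z)) := by
          rw [h1, mul_one]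
      _ = _ := by rw [← mul_assoc, Ring.inverse_mul_cancel _ hA, one_mul]
  rw [RV, hinv]
  nth_rw 1 [F.invSqrt_eq z hz.1]
  rw [F.invSqrt_eq' z hz.1]
  calc S * M z * (N z * Ring.inverse D * N z) * (M z * S)
      = S * (M z * N z) * Ring.inverse D * (N z * M z) * S := by simp only [mul_assoc]
    _ = _ := by rw [F.inv_mul z hz.1, F.mul_inv z hz.1, mul_one, mul_one]

theorem RV_sub_RV {z w : ℂ} (hz : z ∈ regularSet H₀ V) (hw : w ∈ regularSet H₀ V) :
    RV H₀ V w - RV H₀ V z = (w - z) • (RV H₀ V w * RV H₀ V z) := by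
  have hD := F.isUnit_of_mem hz
  have hD' := F.isUnit_of_mem hw
  rw [F.RV_eq hz, F.RV_eq hw]
  have hsub : (1 + W - (1 + z) • (S * S)) - (1 + W - (1 + w) • (S * S)) =
      -- The two factors $S$ in $D(z)-D(w)$ complete the outer ones to the product $R(w)R(z)$.
      (w - z) • (S * S) := by module
  generalize 1 + W - (1 + z) • (S * S) = D at *
  generalize 1 + W - (1 + w) • (S * S) = D' at *
  have h : Ring.inverse D' - Ring.inverse D = Ring.inverse D' * (D - D') * Ring.inverse D := by
    rw [mul_sub, sub_mul, Ring.inverse_mul_cancel _ hD', one_mul, mul_assoc,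
      Ring.mul_inverse_cancel _ hD, mul_one]
  calc S * Ring.inverse D' * S - S * Ring.inverse D * S
      = S * (Ring.inverse D' - Ring.inverse D) * S := by rw [mul_sub, sub_mul]
    _ = _ := by
      rw [h, hsub]
      simp only [mul_smul_comm, smul_mul_assoc, mul_assoc]

theorem denseRange_S : DenseRange S := by
  have h : (S.range)ᗮ = ⊥ := by
    rw [ContinuousLinearMap.orthogonal_range, ← ContinuousLinearMap.star_eq_adjoint,
      F.isSelfAdjoint.star_eq]
    exact LinearMap.ker_eq_bot'.2 F.eq_zero
  have := Submodule.topologicalClosure_eq_top_iff.2 h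
  exact Submodule.dense_iff_topologicalClosure_eq_top.2 this

theorem denseRange_RV {z : ℂ} (hz : z ∈ regularSet H₀ V) : DenseRange (RV H₀ V z) := by
  have hD := F.isUnit_of_mem hz
  rw [F.RV_eq hz]
  generalize 1 + W - (1 + z) • (S * S) = D at *
  have hs : Function.Surjective ⇑(Ring.inverse D) := fun y =>
    ⟨D y, congrArg (fun F => F y) (Ring.inverse_mul_cancel _ hD)⟩
  exact (F.denseRange_S.comp hs.denseRange S.continuous).comp F.denseRange_S
    (S * Ring.inverse D).continuous

theorem RV_eq_zero {z : ℂ} (hz : z ∈ regularSet H₀ V) (y : 𝓗) (hy : RV H₀ V z y = 0) : y = 0 := by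
  have hD := F.isUnit_of_mem hz
  rw [F.RV_eq hz] at hy
  generalize 1 + W - (1 + z) • (S * S) = D at *
  apply F.eq_zero
  have h := F.eq_zero (Ring.inverse D (S y)) hy
  have h' : D (Ring.inverse D (S y)) = S y :=
    congrArg (fun F => F (S y)) (Ring.mul_inverse_cancel _ hD)
  rw [← h', h, map_zero]

theorem invSqrt_eq_zero {z : ℂ} (hz : z ∈ rho H₀) {g : 𝓗} (hg : invSqrt H₀ z g = 0) : g = 0 := by
  rw [F.invSqrt_eq z hz] at hg
  have h : M z g = 0 := F.eq_zero _ hg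
  have h' : N z (M z g) = g := congrArg (fun F => F g) (F.mul_inv z hz)
  rw [← h', h, map_zero]

/-- The vectors fixed by `(l - z) R(z)` are the images of the vectors fixed by `A_V(l)`. -/
theorem smul_RV_apply_eq_iff {z l : ℂ} (hz : z ∈ regularSet H₀ V) (hl : l ∈ rho H₀) (f : 𝓗) :
    (l - z) • RV H₀ V z f = f ↔ ∃ g, AV H₀ V l g = g ∧ invSqrt H₀ l g = f := by
  have hD := F.isUnit_of_mem hz
  rw [F.RV_eq hz]
  have hl' := F.mul_one_sub_AV_mul hl
  have hsub : 1 + W - (1 + l) • (S * S) =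
      (1 + W - (1 + z) • (S * S)) - (l - z) • (S * S) := by module
  rw [hsub] at hl'
  generalize 1 + W - (1 + z) • (S * S) = D at *
  have hNM : ∀ g, N l (M l g) = g := fun g => congrArg (fun F => F g) (F.mul_inv l hl)
  have hMN : ∀ g, M l (N l g) = g := fun g => congrArg (fun F => F g) (F.inv_mul l hl)
  have hDi : ∀ g, D (Ring.inverse D g) = g := fun g =>
    congrArg (fun F => F g) (Ring.mul_inverse_cancel _ hD)
  have hiD : ∀ g, Ring.inverse D (D g) = g := fun g =>
    congrArg (fun F => F g) (Ring.inverse_mul_cancel _ hD)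
  have hA : ∀ u, N l (N l u - AV H₀ V l (N l u)) = D u - (l - z) • S (S u) := fun u =>
    congrArg (fun F => F u) hl'
  have hI : ∀ g, invSqrt H₀ l g = S (M l g) := fun g => by rw [F.invSqrt_eq l hl]; rfl
  constructor
  · intro h
    -- Here $D=D(z)$. The equation for $f$ reads $Su=f$ for this $u$, and `h1` below says
    -- $D(\lambda)u=0$.
    set u := (l - z) • Ring.inverse D (S f) with hudef
    have hSu : S u = f := by rw [hudef, map_smul]; exact h
    refine ⟨N l u, ?_, by rw [hI, hMN, hSu]⟩
    have h1 : D u - (l - z) • S (S u) = 0 := by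
      rw [hSu, hudef, map_smul, hDi, sub_self]
    rw [← hA] at h1
    have h2 := congrArg (M l) h1
    rw [hMN, map_zero, sub_eq_zero] at h2
    exact h2.symm
  · rintro ⟨g, hg, rfl⟩
    -- Conversely, $u=M(\lambda)g$ satisfies $D(\lambda)u=0$, that is, $D(z)u=(\lambda-z)S^2u$.
    have h1 := hA (M l g)
    rw [hNM, hg, sub_self, map_zero, eq_comm, sub_eq_zero] at h1
    change (l - z) • S (Ring.inverse D (S (invSqrt H₀ l g))) = _
    rw [hI, ← map_smul, ← map_smul, ← h1, hiD]

/-- Compactness at one point is compactness of $W=-N(z)A_V(z)N(z)$, which does not involve $z$. -/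
theorem isCompactOperator_AV (h : ∃ z ∈ rho H₀, IsCompactOperator (AV H₀ V z)) {l : ℂ}
    (hl : l ∈ rho H₀) : IsCompactOperator (AV H₀ V l) := by
  obtain ⟨z, hz, hc⟩ := h
  have hW : W = -(N z * AV H₀ V z * N z) := by
    rw [F.AV_eq z hz, mul_neg, neg_mul, neg_neg,
      show N z * (M z * W * M z) * N z = (N z * M z) * W * (M z * N z) by simp only [mul_assoc],
      F.mul_inv z hz, F.inv_mul z hz, one_mul, mul_one]
  have hWc : IsCompactOperator W := by
    rw [hW]
    exact ((hc.clm_comp (N z)).comp_clm (N z)).neg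
  rw [F.AV_eq l hl]
  exact ((hWc.clm_comp (M l)).comp_clm (M l)).neg

end IsFactorization

/-! ### The Fredholm alternative and the main theorem -/

theorem finiteDimensional_ker_one_sub {A : 𝓗 →L[ℂ] 𝓗} (hA : IsCompactOperator A) :
    FiniteDimensional ℂ (LinearMap.ker ((1 - A : 𝓗 →L[ℂ] 𝓗) : 𝓗 →ₗ[ℂ] 𝓗)) := by
  have h : LinearMap.ker ((1 - A : 𝓗 →L[ℂ] 𝓗) : 𝓗 →ₗ[ℂ] 𝓗) =
      Module.End.eigenspace A.toLinearMap 1 := by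
    ext x
    rw [Module.End.mem_eigenspace_iff, one_smul, LinearMap.mem_ker]
    change x - A x = 0 ↔ A x = x
    rw [sub_eq_zero, eq_comm]
  rw [h]
  exact ContinuousLinearMap.finite_dimensional_eigenspace hA 1 one_ne_zero

theorem one_mem_resolventSet_of_ker {A : 𝓗 →L[ℂ] 𝓗} (hA : IsCompactOperator A)
    (h : ∀ g, A g = g → g = 0) : (1 : ℂ) ∈ resolventSet ℂ A := by
  refine (hA.hasEigenvalue_or_mem_resolventSet one_ne_zero).resolve_left fun he => ?_
  obtain ⟨g, hg⟩ := he.exists_hasEigenvector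
  exact hg.2 (h g (by simpa using hg.apply_eq_smul))

end

end BirmanSchwinger

theorem theorem2p11 {𝓗 : Type*} [NormedAddCommGroup 𝓗] [InnerProductSpace ℂ 𝓗] [CompleteSpace 𝓗]
    [TopologicalSpace.SeparableSpace 𝓗]
    (H₀ : 𝓗 →ₗ.[ℂ] 𝓗) (hsa : IsSelfAdjoint H₀)
    (hnonneg : ∀ x : H₀.domain, 0 ≤ (inner ℂ (x : 𝓗) (H₀ x)).re)
    (V : BirmanSchwinger.HPlus H₀ →L[ℂ] BirmanSchwinger.HMinus H₀)
    (hcompact : ∃ z ∈ BirmanSchwinger.rho H₀, IsCompactOperator (BirmanSchwinger.AV H₀ V z))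
    (hnorm : ∃ E₀ : ℝ, E₀ < 0 ∧ ‖BirmanSchwinger.AV H₀ V (E₀ : ℂ)‖ < 1)
    (z₀ : ℂ) (hz₀ : z₀ ∈ BirmanSchwinger.regularSet H₀ V)
    (H : 𝓗 →ₗ.[ℂ] 𝓗) (hH : H = BirmanSchwinger.perturbedOp H₀ V z₀) :
    -- `H` is densely defined and closed, and `R(z) = (H - z)⁻¹` for all admissible `z`
    (Dense (H.domain : Set 𝓗) ∧ H.IsClosed ∧
      ∀ z ∈ BirmanSchwinger.regularSet H₀ V,
        BirmanSchwinger.IsResolventAt H z (BirmanSchwinger.RV H₀ V z)) ∧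
    (∀ l₀ ∈ BirmanSchwinger.rho H₀,
      -- from eigenvectors of `H` to eigenvectors of `A_V(l₀)`
      (∀ f : H.domain, (f : 𝓗) ≠ 0 → H f = l₀ • (f : 𝓗) →
        ∃ hf : (f : 𝓗) ∈ (BirmanSchwinger.sqrtOp H₀ l₀).domain,
          BirmanSchwinger.sqrtOp H₀ l₀ ⟨f, hf⟩ ≠ 0 ∧
          BirmanSchwinger.AV H₀ V l₀ (BirmanSchwinger.sqrtOp H₀ l₀ ⟨f, hf⟩) =
            BirmanSchwinger.sqrtOp H₀ l₀ ⟨f, hf⟩) ∧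
      -- and back
      (∀ g : 𝓗, g ≠ 0 → BirmanSchwinger.AV H₀ V l₀ g = g →
        BirmanSchwinger.invSqrt H₀ l₀ g ≠ 0 ∧
        ∃ hf : BirmanSchwinger.invSqrt H₀ l₀ g ∈ H.domain,
          H ⟨BirmanSchwinger.invSqrt H₀ l₀ g, hf⟩ = l₀ • BirmanSchwinger.invSqrt H₀ l₀ g) ∧
      -- the geometric multiplicities are finite and coincide
      (FiniteDimensional ℂ (BirmanSchwinger.eigenspace H l₀) ∧
        FiniteDimensional ℂ
          (LinearMap.ker ((1 - BirmanSchwinger.AV H₀ V l₀ : 𝓗 →L[ℂ] 𝓗) : 𝓗 →ₗ[ℂ] 𝓗)) ∧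
        Module.finrank ℂ (BirmanSchwinger.eigenspace H l₀) =
          Module.finrank ℂ
            (LinearMap.ker ((1 - BirmanSchwinger.AV H₀ V l₀ : 𝓗 →L[ℂ] 𝓗) : 𝓗 →ₗ[ℂ] 𝓗)))) ∧
    (∀ z ∈ BirmanSchwinger.rho H₀,
      z ∈ BirmanSchwinger.rho H ↔ (1 : ℂ) ∈ resolventSet ℂ (BirmanSchwinger.AV H₀ V z)) := by
  obtain ⟨S, W, N, M, F⟩ := BirmanSchwinger.exists_isFactorization hsa hnonneg V
  have hres₀ : BirmanSchwinger.IsResolventAt H z₀ (BirmanSchwinger.RV H₀ V z₀) :=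
    hH ▸ BirmanSchwinger.isResolventAt_vadd_inverse (F.RV_eq_zero hz₀) z₀
  have hres : ∀ z ∈ BirmanSchwinger.regularSet H₀ V,
      BirmanSchwinger.IsResolventAt H z (BirmanSchwinger.RV H₀ V z) := fun z hz => by
    refine hres₀.of_resolvent_identity ?_ (F.RV_sub_RV hz₀ hz)
    -- The other order of the product comes from exchanging $z$ and $z_0$.
    rw [← neg_sub, F.RV_sub_RV hz hz₀, ← neg_smul, neg_sub]
  have heig : ∀ l ∈ BirmanSchwinger.rho H₀, ∀ f, f ∈ BirmanSchwinger.eigenspace H l ↔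
      ∃ g, BirmanSchwinger.AV H₀ V l g = g ∧ BirmanSchwinger.invSqrt H₀ l g = f :=
    fun l hl f => (hres₀.mem_eigenspace_iff l f).trans (F.smul_RV_apply_eq_iff hz₀ hl f)
  refine ⟨⟨?_, hres₀.isClosed, hres⟩, fun l hl => ⟨fun f hf hHf => ?_, fun g hg hAg => ?_, ?_⟩,
    fun z hz => ⟨fun hzH => ?_, fun h1 => ⟨_, hres z ⟨hz, h1⟩⟩⟩⟩
  · refine (F.denseRange_RV hz₀).mono ?_
    rintro _ ⟨y, rfl⟩
    exact (hres₀.1 y).1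
  · obtain ⟨g, hAg, hgf⟩ := (heig l hl f).1
      ((BirmanSchwinger.mem_eigenspace_iff H l f).2 ⟨f.2, hHf⟩)
    -- Since $f=SM(\lambda)g$, applying $(H_0-\lambda)^{1/2}$ gives $N(\lambda)M(\lambda)g=g$.
    obtain ⟨h, h'⟩ := F.sqrtOp_apply l hl (M l g)
    have e : S (M l g) = f := by rw [← hgf, F.invSqrt_eq l hl]; rfl
    have eg : N l (M l g) = g := congrArg (fun T => T g) (F.mul_inv l hl)
    have hfd : (f : 𝓗) ∈ (BirmanSchwinger.sqrtOp H₀ l).domain := e ▸ h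
    have hfg : BirmanSchwinger.sqrtOp H₀ l ⟨f, hfd⟩ = g := by
      have e' : (⟨f, hfd⟩ : (BirmanSchwinger.sqrtOp H₀ l).domain) = ⟨_, h⟩ := Subtype.ext e.symm
      rw [e', h', eg]
    refine ⟨hfd, ?_, ?_⟩
    · rw [hfg]
      rintro rfl
      exact hf (by rw [← hgf, map_zero])
    · rw [hfg, hAg]
  · exact ⟨fun h => hg (F.invSqrt_eq_zero hl h),
      (BirmanSchwinger.mem_eigenspace_iff H l _).1 ((heig l hl _).2 ⟨g, hAg, rfl⟩)⟩
  · have hfin := BirmanSchwinger.finiteDimensional_ker_one_sub (F.isCompactOperator_AV hcompact hl)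
    have hinj : Function.Injective (BirmanSchwinger.invSqrt H₀ l : 𝓗 →ₗ[ℂ] 𝓗) :=
      LinearMap.ker_eq_bot.1 (LinearMap.ker_eq_bot'.2 fun g hg => F.invSqrt_eq_zero hl hg)
    have hmap : BirmanSchwinger.eigenspace H l =
        (LinearMap.ker ((1 - BirmanSchwinger.AV H₀ V l : 𝓗 →L[ℂ] 𝓗) : 𝓗 →ₗ[ℂ] 𝓗)).map
          (BirmanSchwinger.invSqrt H₀ l : 𝓗 →ₗ[ℂ] 𝓗) := by
      ext f
      rw [heig l hl, Submodule.mem_map]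
      refine exists_congr fun g => and_congr_left fun _ => ?_
      rw [LinearMap.mem_ker]
      change _ ↔ g - BirmanSchwinger.AV H₀ V l g = 0
      rw [sub_eq_zero, eq_comm]
    have eqv := Submodule.equivMapOfInjective _ hinj
      (LinearMap.ker ((1 - BirmanSchwinger.AV H₀ V l : 𝓗 →L[ℂ] 𝓗) : 𝓗 →ₗ[ℂ] 𝓗))
    rw [hmap]
    exact ⟨eqv.finiteDimensional, hfin, eqv.finrank_eq.symm⟩
  -- A fixed vector of $A_V(z)$ would give an element of $\ker(H-z)=0$ through the injective
  -- $(H_0-z)^{-1/2}$.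
  · refine BirmanSchwinger.one_mem_resolventSet_of_ker (F.isCompactOperator_AV hcompact hz)
      fun g hg => F.invSqrt_eq_zero hz ?_
    have h : BirmanSchwinger.invSqrt H₀ z g ∈ BirmanSchwinger.eigenspace H z :=
      (heig z hz _).2 ⟨g, hg, rfl⟩
    rwa [BirmanSchwinger.eigenspace_eq_bot hzH, Submodule.mem_bot] at h
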